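/- Let $p$ be a prime, let $G = C_p$ be a group of order $p$, and let $\mathbb{F}$ be a field of characteristic $p$. Let $\underline{\mathbb{F}}$ be the constant $G$-Green functor on $\mathbb{F}$: $\underline{\mathbb{F}}(G/G) = \underline{\mathbb{F}}(G/e) = \mathbb{F}$, with trivial $G$-action, restriction the identity, and transfer multiplication by $p$ (that is, zero). Then for every finitely generated $\underline{\mathbb{F}}$-module $M$ the following are equivalent: 1. $M$ is flat, i.e. the functor $M \boxtimes_{\underline{\mathbb{F}}} -$ on $\underline{\mathbb{F}}$-modules (relative box product) is exact; 2. $M$ is a projective object of the category of $\underline{\mathbb{F}}$-modules; 3. $M$ is free, i.e. a direct sum of copies of the $\underline{\mathbb{F}}$-modules that represent the functors $N \mapsto N(G/G)$ and $N \mapsto N(G/e)$ (equivalently, of copies of $\underline{\mathbb{F}}$ and $\mathrm{CoInd}_e^{G}\,\mathbb{F}$). In particular, a finitely generated $\underline{\mathbb{F}}$-module is flat if and only if it is free. -/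

import Mathlib

/-! Mackey-functor algebra for a group `G` of prime order.  Such a group has exactly the two orbits
`G/G` and `G/e`, so a Mackey functor is given by its Lewis diagram: a level `top = (G/G)`, a level
`bot = (G/e)` with an action of `G`, a restriction `top → bot` and a transfer `bot → top`. -/

universe u w

/-- A commutative Green functor for a group `G` of prime order. -/
structure GreenFunctor (G : Type w) [Group G] [Fintype G] where
  /-- the value at `G/G` -/
  top : Type u
  /-- the value at `G/e` -/
  bot : Type u
  [ringTop : CommRing top]
  [ringBot : CommRing bot]
  /-- the Weyl action on the value at `G/e` -/
  act : G →* (bot →+* bot)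
  res : top →+* bot
  tr : bot →+ top
  act_res : ∀ g a, act g (res a) = res a
  tr_act : ∀ g b, tr (act g b) = tr b
  res_tr : ∀ b, res (tr b) = ∑ g : G, act g b
  /-- Frobenius reciprocity -/
  tr_mul_res : ∀ b a, tr (b * res a) = tr b * a

attribute [instance] GreenFunctor.ringTop GreenFunctor.ringBot

/-- The constant Green functor on a commutative ring `R`: both values are `R`, the action is
trivial, the restriction is the identity and the transfer is multiplication by `|G|`. -/
def GreenFunctor.const (G : Type w) [Group G] [Fintype G] (R : Type u) [CommRing R] :
    GreenFunctor.{u} G where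
  top := R
  bot := R
  act := 1
  res := RingHom.id R
  tr := Fintype.card G • AddMonoidHom.id R
  act_res := by intro g a; rfl
  tr_act := by intro g b; rfl
  res_tr := by intro b; simp
  tr_mul_res := by intro b a; simp [mul_assoc]

section

variable {G : Type w} [Group G] [Fintype G]

/-- A module over the Green functor `k`: a Mackey functor whose two values are modules over the two
values of `k`, compatibly with restriction, the action, and transfer (Frobenius reciprocity). -/
structure GreenModule (k : GreenFunctor.{u} G) where
  /-- the value at `G/G` -/
  top : Type u
  /-- the value at `G/e` -/
  bot : Type u
  [groupTop : AddCommGroup top]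
  [groupBot : AddCommGroup bot]
  [moduleTop : Module k.top top]
  [moduleBot : Module k.bot bot]
  /-- the Weyl action on the value at `G/e` -/
  act : G →* AddMonoid.End bot
  res : top →+ bot
  tr : bot →+ top
  act_res : ∀ g m, act g (res m) = res m
  tr_act : ∀ g x, tr (act g x) = tr x
  res_tr : ∀ x, res (tr x) = ∑ g : G, act g x
  act_smul : ∀ g (b : k.bot) x, act g (b • x) = k.act g b • act g x
  res_smul : ∀ (a : k.top) m, res (a • m) = k.res a • res m
  tr_res_smul : ∀ (a : k.top) x, tr (k.res a • x) = a • tr x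
  tr_smul_res : ∀ (b : k.bot) m, tr (b • res m) = k.tr b • m

attribute [instance] GreenModule.groupTop GreenModule.groupBot
attribute [instance] GreenModule.moduleTop GreenModule.moduleBot

namespace GreenModule

variable {k : GreenFunctor.{u} G}

/-- Morphisms of `k`-modules: levelwise linear maps commuting with all structure maps. -/
@[ext]
structure Hom (M N : GreenModule k) where
  top : M.top →ₗ[k.top] N.top
  bot : M.bot →ₗ[k.bot] N.bot
  map_act : ∀ g x, bot (M.act g x) = N.act g (bot x)
  map_res : ∀ m, bot (M.res m) = N.res (top m)
  map_tr : ∀ x, top (M.tr x) = N.tr (bot x)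

instance : CategoryTheory.Category (GreenModule k) where
  Hom := Hom
  id M :=
    { top := LinearMap.id
      bot := LinearMap.id
      map_act := fun _ _ => rfl
      map_res := fun _ => rfl
      map_tr := fun _ => rfl }
  comp f g :=
    { top := g.top ∘ₗ f.top
      bot := g.bot ∘ₗ f.bot
      map_act := fun h x => by simp [f.map_act, g.map_act]
      map_res := fun m => by simp [f.map_res, g.map_res]
      map_tr := fun x => by simp [f.map_tr, g.map_tr] }

/-- `k(G/G)` acts on `M(G/e)` through the restriction of `k`. -/
instance moduleTopBot (M : GreenModule k) : Module k.top M.bot := Module.compHom M.bot k.res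

theorem top_smul_bot (M : GreenModule k) (a : k.top) (x : M.bot) : a • x = k.res a • x := rfl

instance smulCommTopBot (M : GreenModule k) : SMulCommClass k.bot k.top M.bot where
  smul_comm b a x := by rw [top_smul_bot, top_smul_bot, smul_comm]

/-! ### The box product over `k` -/

open TensorProduct

namespace Box

variable (M N : GreenModule k)

/-- The value of the box product at `G/e`. -/
abbrev Bot : Type u := M.bot ⊗[k.bot] N.bot

theorem top_smul (a : k.top) (w : Bot M N) : a • w = k.res a • w := by
  induction w using TensorProduct.induction_on with
  | zero => simp
  | tmul x y => rw [TensorProduct.smul_tmul', TensorProduct.smul_tmul', top_smul_bot]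
  | add v w hv hw => rw [smul_add, smul_add, hv, hw]

/-- The diagonal action, on one element of the group. -/
def actHom (g : G) : Bot M N →+ Bot M N :=
  TensorProduct.liftAddHom
    { toFun := fun x =>
        { toFun := fun y => M.act g x ⊗ₜ N.act g y
          map_zero' := by simp
          map_add' := fun y y' => by rw [map_add, TensorProduct.tmul_add] }
      map_zero' := by ext y; simp
      map_add' := fun x x' => by ext y; simp [TensorProduct.add_tmul] }
    (fun b x y => by simp [act_smul, TensorProduct.smul_tmul])

@[simp]
theorem actHom_tmul (g : G) (x : M.bot) (y : N.bot) :
    actHom M N g (x ⊗ₜ y) = M.act g x ⊗ₜ N.act g y := rfl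

/-- The diagonal action of `G` on the value at `G/e`. -/
def act : G →* AddMonoid.End (Bot M N) where
  toFun g := actHom M N g
  map_one' := by
    refine AddMonoidHom.ext fun w => ?_
    change actHom M N 1 w = w
    induction w using TensorProduct.induction_on with
    | zero => exact map_zero _
    | tmul x y => rw [actHom_tmul, map_one, map_one]; rfl
    | add v w hv hw => rw [map_add, hv, hw]
  map_mul' g h := by
    refine AddMonoidHom.ext fun w => ?_
    change actHom M N (g * h) w = actHom M N g (actHom M N h w)
    induction w using TensorProduct.induction_on with
    | zero => rw [map_zero, map_zero, map_zero]
    | tmul x y => rw [actHom_tmul, map_mul, map_mul]; rfl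
    | add v w hv hw => rw [map_add, map_add, map_add, hv, hw]

@[simp]
theorem act_tmul (g : G) (x : M.bot) (y : N.bot) :
    act M N g (x ⊗ₜ y) = M.act g x ⊗ₜ N.act g y := rfl

theorem act_smul (g : G) (b : k.bot) (w : Bot M N) :
    act M N g (b • w) = k.act g b • act M N g w := by
  induction w using TensorProduct.induction_on with
  | zero => simp
  | tmul x y => simp [TensorProduct.smul_tmul', GreenModule.act_smul]
  | add v w hv hw => simp_all

theorem act_inv_act (g : G) (w : Bot M N) : act M N g⁻¹ (act M N g w) = w := by
  change (act M N g⁻¹ * act M N g) w = w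
  rw [← map_mul, inv_mul_cancel, map_one]
  rfl

/-- Generators of the value at `G/G`: products of elements at `G/G`, and formal transfers of
elements of the box product at `G/e`. -/
abbrev Pre : Type u := (M.top ⊗[k.top] N.top) × Bot M N

/-- The relations at `G/G`: Frobenius reciprocity on both sides, and invariance of formal transfers
under the action. -/
def rel : Submodule k.top (Pre M N) :=
  Submodule.span k.top
    ({z | ∃ (x : M.bot) (n : N.top), z = (M.tr x ⊗ₜ n, -(x ⊗ₜ N.res n))} ∪
      {z | ∃ (m : M.top) (y : N.bot), z = (m ⊗ₜ N.tr y, -(M.res m ⊗ₜ y))} ∪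
      {z | ∃ (g : G) (w : Bot M N), z = (0, act M N g w - w)})

/-- The value of the box product at `G/G`. -/
abbrev Top : Type u := Pre M N ⧸ rel M N

/-- The class of `m ⊗ n` with `m ∈ M(G/G)` and `n ∈ N(G/G)`. -/
def inl : (M.top ⊗[k.top] N.top) →ₗ[k.top] Top M N :=
  (rel M N).mkQ ∘ₗ LinearMap.inl k.top _ _

/-- The transfer of the box product. -/
def tr : Bot M N →ₗ[k.top] Top M N :=
  (rel M N).mkQ ∘ₗ LinearMap.inr k.top _ _

theorem inl_tr_left (x : M.bot) (n : N.top) :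
    inl M N (M.tr x ⊗ₜ n) = tr M N (x ⊗ₜ N.res n) := by
  refine (Submodule.Quotient.eq _).2 (Submodule.subset_span (Or.inl (Or.inl ⟨x, n, ?_⟩)))
  simp

theorem inl_tr_right (m : M.top) (y : N.bot) :
    inl M N (m ⊗ₜ N.tr y) = tr M N (M.res m ⊗ₜ y) := by
  refine (Submodule.Quotient.eq _).2 (Submodule.subset_span (Or.inl (Or.inr ⟨m, y, ?_⟩)))
  simp

theorem tr_act (g : G) (w : Bot M N) : tr M N (act M N g w) = tr M N w := by
  refine (Submodule.Quotient.eq _).2 (Submodule.subset_span (Or.inr ⟨g, w, ?_⟩))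
  simp

variable {M N}

/-- Linear maps out of the value at `G/G`. -/
def lift {P : Type*} [AddCommGroup P] [Module k.top P]
    (α : (M.top ⊗[k.top] N.top) →ₗ[k.top] P) (β : Bot M N →ₗ[k.top] P)
    (h₁ : ∀ x n, α (M.tr x ⊗ₜ n) = β (x ⊗ₜ N.res n))
    (h₂ : ∀ m y, α (m ⊗ₜ N.tr y) = β (M.res m ⊗ₜ y))
    (h₃ : ∀ g w, β (act M N g w) = β w) : Top M N →ₗ[k.top] P :=
  (rel M N).liftQ (α.coprod β) (by
    refine Submodule.span_le.2 ?_
    rintro z ((⟨x, n, rfl⟩ | ⟨m, y, rfl⟩) | ⟨g, w, rfl⟩)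
    · simp [h₁]
    · simp [h₂]
    · simp [h₃])

@[simp]
theorem lift_inl {P : Type*} [AddCommGroup P] [Module k.top P]
    (α : (M.top ⊗[k.top] N.top) →ₗ[k.top] P) (β : Bot M N →ₗ[k.top] P) (h₁ h₂ h₃)
    (z : M.top ⊗[k.top] N.top) : lift α β h₁ h₂ h₃ (inl M N z) = α z := by
  change α z + β 0 = α z
  rw [map_zero, add_zero]

@[simp]
theorem lift_tr {P : Type*} [AddCommGroup P] [Module k.top P]
    (α : (M.top ⊗[k.top] N.top) →ₗ[k.top] P) (β : Bot M N →ₗ[k.top] P) (h₁ h₂ h₃)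
    (w : Bot M N) : lift α β h₁ h₂ h₃ (tr M N w) = β w := by
  change α 0 + β w = β w
  rw [map_zero, zero_add]

theorem top_induction {motive : Top M N → Prop}
    (hl : ∀ m n, motive (inl M N (m ⊗ₜ n))) (hr : ∀ w, motive (tr M N w))
    (ha : ∀ z z', motive z → motive z' → motive (z + z')) (z : Top M N) : motive z := by
  have hs : ∀ s, motive (inl M N s) := fun s => by
    induction s using TensorProduct.induction_on with
    | zero => simpa using hr 0
    | tmul m n => exact hl m n
    | add s t hs ht => rw [map_add]; exact ha _ _ hs ht
  obtain ⟨⟨s, w⟩, rfl⟩ := (rel M N).mkQ_surjective z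
  have e : (rel M N).mkQ (s, w) = inl M N s + tr M N w := by
    change (rel M N).mkQ (s, w) = (rel M N).mkQ (s, 0) + (rel M N).mkQ (0, w)
    rw [← map_add, Prod.mk_add_mk, add_zero, zero_add]
  rw [e]
  exact ha _ _ (hs s) (hr w)

variable (M N)

/-- The restriction on products of elements at `G/G`. -/
def resInl : (M.top ⊗[k.top] N.top) →ₗ[k.top] Bot M N :=
  TensorProduct.lift (LinearMap.mk₂ k.top (fun m n => M.res m ⊗ₜ[k.bot] N.res n)
    (fun m m' n => by rw [map_add, TensorProduct.add_tmul])
    (fun a m n => by rw [res_smul, top_smul, TensorProduct.smul_tmul'])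
    (fun m n n' => by rw [map_add, TensorProduct.tmul_add])
    (fun a m n => by rw [res_smul, top_smul, TensorProduct.tmul_smul]))

@[simp]
theorem resInl_tmul (m : M.top) (n : N.top) :
    resInl M N (m ⊗ₜ n) = M.res m ⊗ₜ[k.bot] N.res n := rfl

/-- The sum over the action of `G`. -/
def norm : Bot M N →ₗ[k.top] Bot M N where
  toFun w := ∑ g : G, act M N g w
  map_add' v w := by simp [Finset.sum_add_distrib]
  map_smul' a w := by simp [top_smul, act_smul, k.act_res, Finset.smul_sum]

theorem norm_apply (w : Bot M N) : norm M N w = ∑ g : G, act M N g w := rfl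

/-- The restriction of the box product: it is multiplicative, and a transfer restricts to the sum
over the action. -/
def res : Top M N →ₗ[k.top] Bot M N :=
  lift (resInl M N) (norm M N)
    (fun x n => by
      simp [norm_apply, M.res_tr, TensorProduct.sum_tmul, N.act_res])
    (fun m y => by
      simp [norm_apply, N.res_tr, TensorProduct.tmul_sum, M.act_res])
    (fun g w => by
      simp only [norm_apply]
      refine Fintype.sum_equiv (Equiv.mulRight g) _ _ fun h => ?_
      simp)

@[simp]
theorem res_inl (m : M.top) (n : N.top) :
    res M N (inl M N (m ⊗ₜ n)) = M.res m ⊗ₜ[k.bot] N.res n := lift_inl ..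

@[simp]
theorem res_tr (w : Bot M N) : res M N (tr M N w) = norm M N w := lift_tr ..

end Box

/-- The box product `M ⊠ₖ N` of two modules over the Green functor `k`. -/
def box (M N : GreenModule k) : GreenModule k where
  top := Box.Top M N
  bot := Box.Bot M N
  act := Box.act M N
  res := (Box.res M N).toAddMonoidHom
  tr := (Box.tr M N).toAddMonoidHom
  act_res g z := by
    change Box.act M N g (Box.res M N z) = Box.res M N z
    induction z using Box.top_induction with
    | hl m n => simp [act_res]
    | hr w =>
      simp only [Box.res_tr, Box.norm_apply, map_sum]
      refine Fintype.sum_equiv (Equiv.mulLeft g) _ _ fun h => ?_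
      simp
    | ha z z' h h' => rw [map_add, map_add, h, h']
  tr_act g w := Box.tr_act M N g w
  res_tr w := Box.res_tr M N w
  act_smul := Box.act_smul M N
  res_smul a z := by simp [Box.top_smul]
  tr_res_smul a w := by simp [← Box.top_smul]
  tr_smul_res b z := by
    change Box.tr M N (b • Box.res M N z) = k.tr b • z
    induction z using Box.top_induction with
    | hl m n =>
      rw [Box.res_inl, TensorProduct.smul_tmul', ← Box.inl_tr_left, tr_smul_res, ← map_smul,
        TensorProduct.smul_tmul']
    | hr w =>
      rw [Box.res_tr, Box.norm_apply, Finset.smul_sum, map_sum, ← map_smul, Box.top_smul,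
        k.res_tr, Finset.sum_smul, map_sum]
      refine Fintype.sum_equiv (Equiv.inv G) _ _ fun g => ?_
      rw [← Box.tr_act M N g⁻¹, Box.act_smul, Box.act_inv_act]
      rfl
    | ha z z' h h' => rw [map_add, smul_add, map_add, h, h', smul_add]

namespace Box

variable (M : GreenModule k) {N N' : GreenModule k} (f : N ⟶ N')

/-- The map `id ⊗ f` at `G/e`. -/
def mapBot : Bot M N →ₗ[k.bot] Bot M N' := TensorProduct.map LinearMap.id (Hom.bot f)

@[simp]
theorem mapBot_tmul (x : M.bot) (y : N.bot) : mapBot M f (x ⊗ₜ y) = x ⊗ₜ Hom.bot f y := rfl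

theorem mapBot_act (g : G) (w : Bot M N) :
    mapBot M f (act M N g w) = act M N' g (mapBot M f w) := by
  induction w using TensorProduct.induction_on with
  | zero => simp
  | tmul x y => simp [Hom.map_act]
  | add v w hv hw => simp_all

/-- The map `id ⊗ f` at `G/e` as a `k(G/G)`-linear map. -/
def mapBot' : Bot M N →ₗ[k.top] Bot M N' where
  toFun := mapBot M f
  map_add' := map_add _
  map_smul' a w := by simp [top_smul]

/-- The map induced by `f` at `G/G`. -/
def mapTop : Top M N →ₗ[k.top] Top M N' :=
  lift (inl M N' ∘ₗ TensorProduct.map LinearMap.id (Hom.top f)) (tr M N' ∘ₗ mapBot' M f)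
    (fun x n => by
      change inl M N' (M.tr x ⊗ₜ Hom.top f n) = tr M N' (x ⊗ₜ Hom.bot f (N.res n))
      rw [inl_tr_left, f.map_res])
    (fun m y => by
      change inl M N' (m ⊗ₜ Hom.top f (N.tr y)) = tr M N' (M.res m ⊗ₜ Hom.bot f y)
      rw [f.map_tr, inl_tr_right])
    (fun g w => by
      change tr M N' (mapBot M f (act M N g w)) = tr M N' (mapBot M f w)
      rw [mapBot_act, tr_act])

@[simp]
theorem mapTop_inl (m : M.top) (n : N.top) :
    mapTop M f (inl M N (m ⊗ₜ n)) = inl M N' (m ⊗ₜ Hom.top f n) := lift_inl ..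

@[simp]
theorem mapTop_tr (w : Bot M N) : mapTop M f (tr M N w) = tr M N' (mapBot M f w) := lift_tr ..

end Box

/-- The action of the functor `M ⊠ₖ -` on morphisms. -/
def boxMap (M : GreenModule k) {N N' : GreenModule k} (f : N ⟶ N') : M.box N ⟶ M.box N' :=
  { top := Box.mapTop M f
    bot := Box.mapBot M f
    map_act := Box.mapBot_act M f
    map_res := fun z => by
      change Box.mapBot M f (Box.res M N z) = Box.res M N' (Box.mapTop M f z)
      induction z using Box.top_induction with
      | hl m n => simp [f.map_res]
      | hr w => simp [Box.norm_apply, Box.mapBot_act]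
      | ha z z' h h' => rw [map_add, map_add, map_add, map_add, h, h']
    map_tr := fun w => Box.mapTop_tr M f w }

/-- Short exact sequences of `k`-modules (exactness is levelwise). -/
structure IsShortExact {N₁ N₂ N₃ : GreenModule k} (f : N₁ ⟶ N₂) (g : N₂ ⟶ N₃) : Prop where
  injective_top : Function.Injective (Hom.top f)
  injective_bot : Function.Injective (Hom.bot f)
  exact_top : Function.Exact (Hom.top f) (Hom.top g)
  exact_bot : Function.Exact (Hom.bot f) (Hom.bot g)
  surjective_top : Function.Surjective (Hom.top g)
  surjective_bot : Function.Surjective (Hom.bot g)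

/-- `M` is flat if the functor `M ⊠ₖ -` is exact. -/
def IsFlat (M : GreenModule k) : Prop :=
  ∀ ⦃N₁ N₂ N₃ : GreenModule k⦄ (f : N₁ ⟶ N₂) (g : N₂ ⟶ N₃),
    IsShortExact f g → IsShortExact (M.boxMap f) (M.boxMap g)

/-- `M` is free if it has a basis: families of elements of `M(G/G)` and of `M(G/e)` such that a
morphism out of `M` is the same as an arbitrary choice of images for them.  Equivalently `M` is a
direct sum of copies of the modules representing `N ↦ N(G/G)` and `N ↦ N(G/e)`. -/
def IsFree (M : GreenModule k) : Prop :=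
  ∃ (I J : Type u) (x : I → M.top) (y : J → M.bot),
    ∀ (N : GreenModule k) (s : I → N.top) (t : J → N.bot),
      ∃! f : M ⟶ N, (∀ i, Hom.top f (x i) = s i) ∧ (∀ j, Hom.bot f (y j) = t j)

/-- `M` is finitely generated: there are finitely many elements of `M(G/G)` and `M(G/e)` such that
every submodule of `M` containing them is all of `M`. -/
def IsFinitelyGenerated (M : GreenModule k) : Prop :=
  ∃ (A : Finset M.top) (B : Finset M.bot),
    ∀ (S : Submodule k.top M.top) (T : Submodule k.bot M.bot),
      (∀ m ∈ S, M.res m ∈ T) → (∀ x ∈ T, M.tr x ∈ S) → (∀ g, ∀ x ∈ T, M.act g x ∈ T) →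
      (A : Set M.top) ⊆ S → (B : Set M.bot) ⊆ T → S = ⊤ ∧ T = ⊤

end GreenModule

end

namespace GreenModule

open TensorProduct CategoryTheory

/-! ### Modules over the constant Green functor in `F`-linear terms -/

section Constant

variable {G : Type w} [Group G] [Fintype G] {F : Type u} [Field F]

/-! Everything passes through one criterion, `IsTame`: the restriction of `M` is injective, and the
kernel of the transfer is spanned by restrictions and differences `g x - x`.

Tame implies free (`IsTame.exists_isFreeOn`). Let `V` be a complement of the image of the transfer
and `W` a complement of its kernel. The map to `M` from the free module on `V` and `W` is bijective
at `G/G` by linear algebra. At `G/e`, a generator `s` of `G` satisfies `(s - 1) ^ p = s ^ p - 1 =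
0`. Nilpotency lets surjectivity be checked modulo the image of `s - 1`, where the second half of
tameness gives it, and injectivity on fixed vectors, where the first half gives it.

Flat modules are tame (`IsFlat.isTame`): tensor with the inclusion of the constant module into the
module representing `N ↦ N(G/e)`, and with the inclusion of the simple module at `G/e` into the
constant module. Projective modules are tame because they are retracts of free ones
(`isTame_of_projective`).

Conversely, if `M` is free on `V` and `W`, then `(M ⊠ N)(G/G)` is naturally `V ⊗ N(G/G) ⊕ W ⊗
N(G/e)`, which is exact in `N` over a field (`IsFreeOn.isFlat`). Free modules are projective because
epimorphisms are levelwise surjective. -/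

instance fieldModuleTop (M : GreenModule (GreenFunctor.const G F)) : Module F M.top := M.moduleTop

instance fieldModuleBot (M : GreenModule (GreenFunctor.const G F)) : Module F M.bot := M.moduleBot

/-- The restriction as an `F`-linear map. -/
def resL (M : GreenModule (GreenFunctor.const G F)) : M.top →ₗ[F] M.bot where
  toFun := M.res
  map_add' := map_add _
  map_smul' := M.res_smul

/-- The transfer as an `F`-linear map. -/
def trL (M : GreenModule (GreenFunctor.const G F)) : M.bot →ₗ[F] M.top where
  toFun := M.tr
  map_add' := map_add _
  map_smul' := M.tr_res_smul

/-- The value at `G/e` as a representation of `G`. -/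
def rho (M : GreenModule (GreenFunctor.const G F)) : Representation F G M.bot where
  toFun g :=
    { toFun := M.act g
      map_add' := map_add _
      map_smul' := M.act_smul g }
  map_one' := by ext x; exact congrArg (fun a : AddMonoid.End M.bot => a x) (map_one M.act)
  map_mul' g h := by ext x; exact congrArg (fun a : AddMonoid.End M.bot => a x) (map_mul M.act g h)

/-- A morphism at `G/G` as an `F`-linear map. -/
def Hom.topL {M N : GreenModule (GreenFunctor.const G F)} (f : M ⟶ N) : M.top →ₗ[F] N.top :=
  Hom.top f

/-- A morphism at `G/e` as an `F`-linear map. -/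
def Hom.botL {M N : GreenModule (GreenFunctor.const G F)} (f : M ⟶ N) : M.bot →ₗ[F] N.bot :=
  Hom.bot f

section Laws

variable (M : GreenModule (GreenFunctor.const G F))

theorem rho_resL (g : G) (m : M.top) : M.rho g (M.resL m) = M.resL m := M.act_res g m

theorem trL_rho (g : G) (x : M.bot) : M.trL (M.rho g x) = M.trL x := M.tr_act g x

theorem resL_trL (x : M.bot) : M.resL (M.trL x) = ∑ g : G, M.rho g x := M.res_tr x

theorem trL_resL (m : M.top) : M.trL (M.resL m) = (Fintype.card G : F) • m := by
  have h := M.tr_smul_res (1 : F) m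
  have e : (GreenFunctor.const G F).tr (1 : F) = (Fintype.card G : F) := by
    change Fintype.card G • (1 : F) = _
    simp
  rw [e] at h
  refine Eq.trans ?_ h
  exact congrArg M.tr (one_smul F (M.res m)).symm

variable {M} {N : GreenModule (GreenFunctor.const G F)} (f : M ⟶ N)

theorem Hom.botL_rho (g : G) (x : M.bot) : Hom.botL f (M.rho g x) = N.rho g (Hom.botL f x) :=
  Hom.map_act f g x

theorem Hom.botL_resL (m : M.top) : Hom.botL f (M.resL m) = N.resL (Hom.topL f m) :=
  Hom.map_res f m

theorem Hom.topL_trL (x : M.bot) : Hom.topL f (M.trL x) = N.trL (Hom.botL f x) :=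
  Hom.map_tr f x

theorem hom_ext_of_linear {f f' : M ⟶ N} (ht : Hom.topL f = Hom.topL f')
    (hb : Hom.botL f = Hom.botL f') : f = f' :=
  Hom.ext ht hb

end Laws

/-- A module over the constant Green functor of a field, from `F`-linear data. -/
def ofLinear {T B : Type u} [AddCommGroup T] [AddCommGroup B] [Module F T] [Module F B]
    (ρ : Representation F G B) (r : T →ₗ[F] B) (t : B →ₗ[F] T)
    (h₁ : ∀ g m, ρ g (r m) = r m) (h₂ : ∀ g x, t (ρ g x) = t x)
    (h₃ : ∀ x, r (t x) = ∑ g : G, ρ g x) (h₄ : ∀ m, t (r m) = (Fintype.card G : F) • m) :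
    GreenModule (GreenFunctor.const G F) where
  top := T
  bot := B
  moduleTop := inferInstanceAs (Module F T)
  moduleBot := inferInstanceAs (Module F B)
  act :=
    { toFun := fun g => (ρ g).toAddMonoidHom
      map_one' := by rw [map_one]; rfl
      map_mul' := fun g h => by rw [map_mul]; rfl }
  res := r.toAddMonoidHom
  tr := t.toAddMonoidHom
  act_res := h₁
  tr_act := h₂
  res_tr := h₃
  act_smul := fun g b x => (ρ g).map_smul b x
  res_smul := fun a m => r.map_smul a m
  tr_res_smul := fun a x => t.map_smul a x
  tr_smul_res := fun b m => by
    -- `h₄` is Frobenius reciprocity for `b = 1`; linearity gives every other scalar.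
    change t ((show F from b) • r m) = (Fintype.card G • (show F from b)) • m
    rw [map_smul, h₄, nsmul_eq_mul, smul_smul, mul_comm]

/-- A morphism of modules from `F`-linear data. -/
def homOfLinear {M N : GreenModule (GreenFunctor.const G F)} (a : M.top →ₗ[F] N.top)
    (b : M.bot →ₗ[F] N.bot) (h₁ : ∀ g x, b (M.rho g x) = N.rho g (b x))
    (h₂ : ∀ m, b (M.resL m) = N.resL (a m)) (h₃ : ∀ x, a (M.trL x) = N.trL (b x)) : M ⟶ N :=
  { top := a
    bot := b
    map_act := h₁
    map_res := h₂
    map_tr := h₃ }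

/-! ### Cokernels -/

section Cokernel

variable {M N : GreenModule (GreenFunctor.const G F)} (f : M ⟶ N)

theorem range_botL_le_comap_rho (g : G) :
    LinearMap.range (Hom.botL f) ≤ (LinearMap.range (Hom.botL f)).comap (N.rho g) := by
  rintro _ ⟨x, rfl⟩
  exact ⟨M.rho g x, Hom.botL_rho f g x⟩

theorem range_topL_le_comap_resL :
    LinearMap.range (Hom.topL f) ≤ (LinearMap.range (Hom.botL f)).comap N.resL := by
  rintro _ ⟨x, rfl⟩
  exact ⟨M.resL x, Hom.botL_resL f x⟩

theorem range_botL_le_comap_trL :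
    LinearMap.range (Hom.botL f) ≤ (LinearMap.range (Hom.topL f)).comap N.trL := by
  rintro _ ⟨x, rfl⟩
  exact ⟨M.trL x, Hom.topL_trL f x⟩

/-- The action of `G` on the cokernel at `G/e`. -/
def cokerRho : Representation F G (N.bot ⧸ LinearMap.range (Hom.botL f)) where
  toFun g := Submodule.mapQ _ _ (N.rho g) (range_botL_le_comap_rho f g)
  map_one' := by
    refine Submodule.linearMap_qext _ (LinearMap.ext fun x => ?_)
    simp
  map_mul' g h := by
    refine Submodule.linearMap_qext _ (LinearMap.ext fun x => ?_)
    simp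

@[simp]
theorem cokerRho_mk (g : G) (x : N.bot) :
    cokerRho f g (Submodule.Quotient.mk x) = Submodule.Quotient.mk (N.rho g x) := rfl

/-- The levelwise cokernel of a morphism. -/
def coker : GreenModule (GreenFunctor.const G F) :=
  ofLinear (cokerRho f) (Submodule.mapQ _ _ N.resL (range_topL_le_comap_resL f))
    (Submodule.mapQ _ _ N.trL (range_botL_le_comap_trL f))
    (fun g m => by
      obtain ⟨m, rfl⟩ := Submodule.Quotient.mk_surjective _ m
      simp [rho_resL])
    (fun g x => by
      obtain ⟨x, rfl⟩ := Submodule.Quotient.mk_surjective _ x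
      simp [trL_rho])
    (fun x => by
      obtain ⟨x, rfl⟩ := Submodule.Quotient.mk_surjective _ x
      simp only [Submodule.mapQ_apply, resL_trL, cokerRho_mk]
      exact map_sum (Submodule.mkQ _) _ _)
    (fun m => by
      obtain ⟨m, rfl⟩ := Submodule.Quotient.mk_surjective _ m
      simp only [Submodule.mapQ_apply, trL_resL]
      rfl)

/-- The projection to the cokernel. -/
def cokerMk : N ⟶ coker f :=
  homOfLinear (N := coker f) (Submodule.mkQ (LinearMap.range (Hom.topL f)))
    (Submodule.mkQ (LinearMap.range (Hom.botL f)))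
    (fun _ _ => rfl) (fun _ => rfl) (fun _ => rfl)

theorem isShortExact_cokerMk (ht : Function.Injective (Hom.topL f))
    (hb : Function.Injective (Hom.botL f)) : IsShortExact f (cokerMk f) where
  injective_top := ht
  injective_bot := hb
  exact_top := LinearMap.exact_map_mkQ_range (Hom.topL f)
  exact_bot := LinearMap.exact_map_mkQ_range (Hom.botL f)
  surjective_top := Submodule.mkQ_surjective _
  surjective_bot := Submodule.mkQ_surjective _

/-- The zero morphism. -/
def zeroHom (M N : GreenModule (GreenFunctor.const G F)) : M ⟶ N :=
  homOfLinear 0 0 (by simp) (by simp) (by simp)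

/-- The projection to the cokernel agrees with zero after `f`, so it is zero, and the cokernel
vanishes at both levels. -/
theorem surjective_of_epi [Epi f] :
    Function.Surjective (Hom.topL f) ∧ Function.Surjective (Hom.botL f) := by
  have h : cokerMk f = zeroHom N (coker f) := by
    rw [← cancel_epi f]
    refine hom_ext_of_linear (LinearMap.ext fun m => ?_) (LinearMap.ext fun x => ?_)
    · exact (Submodule.Quotient.mk_eq_zero _).2 ⟨m, rfl⟩
    · exact (Submodule.Quotient.mk_eq_zero _).2 ⟨x, rfl⟩
  refine ⟨fun m => ?_, fun x => ?_⟩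
  · exact (Submodule.Quotient.mk_eq_zero _).1 (LinearMap.congr_fun (congrArg Hom.topL h) m)
  · exact (Submodule.Quotient.mk_eq_zero _).1 (LinearMap.congr_fun (congrArg Hom.botL h) x)

theorem epi_of_surjective (ht : Function.Surjective (Hom.topL f))
    (hb : Function.Surjective (Hom.botL f)) : Epi f where
  left_cancellation a b h := by
    refine hom_ext_of_linear (LinearMap.ext fun m => ?_) (LinearMap.ext fun x => ?_)
    · obtain ⟨m, rfl⟩ := ht m
      exact LinearMap.congr_fun (congrArg Hom.topL h) m
    · obtain ⟨x, rfl⟩ := hb x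
      exact LinearMap.congr_fun (congrArg Hom.botL h) x

end Cokernel

/-- Lift the images of the basis elements through `e` and extend; uniqueness on the basis identifies
the composite with `f`. -/
theorem IsFree.projective {M : GreenModule (GreenFunctor.const G F)} (hM : M.IsFree) :
    Projective M where
  factors {E X} f e _ := by
    obtain ⟨I, J, x, y, h⟩ := hM
    obtain ⟨ht, hb⟩ := surjective_of_epi e
    choose s hs using fun i => ht (Hom.topL f (x i))
    choose t hy using fun j => hb (Hom.botL f (y j))
    obtain ⟨l, ⟨hl₁, hl₂⟩, -⟩ := h E s t
    refine ⟨l, (h X (fun i => Hom.topL f (x i)) (fun j => Hom.botL f (y j))).unique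
      ⟨fun i => ?_, fun j => ?_⟩ ⟨fun _ => rfl, fun _ => rfl⟩⟩
    · exact (congrArg (Hom.topL e) (hl₁ i)).trans (hs i)
    · exact (congrArg (Hom.botL e) (hl₂ j)).trans (hy j)

/-! ### Modules that are free on two vector spaces -/

section FreeOn

variable (G)

/-- `G` acts on the functions `G → W` by right translation; the index type is `Fin |G|`, for the
sake of universe levels. -/
noncomputable def translation (W : Type u) [AddCommGroup W] [Module F W] :
    Representation F G (Fin (Fintype.card G) → W) where
  toFun g := LinearMap.funLeft F W
    fun i => Fintype.equivFin G ((Fintype.equivFin G).symm i * g)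
  map_one' := by ext; simp [LinearMap.funLeft]
  map_mul' g h := by
    refine LinearMap.ext fun φ => funext fun i => ?_
    simp [LinearMap.funLeft, mul_assoc]

variable {G}

theorem translation_apply {W : Type u} [AddCommGroup W] [Module F W] (g : G)
    (φ : Fin (Fintype.card G) → W) (i : Fin (Fintype.card G)) :
    translation (F := F) G W g φ i =
      φ (Fintype.equivFin G ((Fintype.equivFin G).symm i * g)) := rfl

omit [Group G] in
theorem sum_fin_card {A : Type*} [AddCommMonoid A] (φ : Fin (Fintype.card G) → A) :
    ∑ i, φ i = ∑ g : G, φ (Fintype.equivFin G g) :=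
  (Fintype.sum_equiv (Fintype.equivFin G) _ _ fun _ => rfl).symm

theorem sum_translation {W : Type u} [AddCommGroup W] [Module F W] (g : G)
    (φ : Fin (Fintype.card G) → W) : ∑ i, translation (F := F) G W g φ i = ∑ i, φ i := by
  rw [sum_fin_card, sum_fin_card]
  exact Fintype.sum_equiv (Equiv.mulRight g) _ _ fun h => by simp [translation_apply]

/-- The norm of `φ` is a constant function, which is why transfer followed by restriction is the
norm in `freeOn`. -/
theorem sum_translation_apply {W : Type u} [AddCommGroup W] [Module F W]
    (φ : Fin (Fintype.card G) → W) (i : Fin (Fintype.card G)) :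
    ∑ g : G, translation (F := F) G W g φ i = ∑ i, φ i := by
  rw [sum_fin_card φ]
  exact Fintype.sum_equiv (Equiv.mulLeft ((Fintype.equivFin G).symm i)) _ _ fun h => by
    simp [translation_apply]

variable (G) (hG : (Fintype.card G : F) = 0)
variable (V W : Type u) [AddCommGroup V] [Module F V] [AddCommGroup W] [Module F W]

/-- The action of `G` on `V × (G → W)`. -/
noncomputable def freeRho : Representation F G (V × (Fin (Fintype.card G) → W)) where
  toFun g := LinearMap.prodMap LinearMap.id (translation G W g)
  map_one' := by rw [map_one]; rfl
  map_mul' g h := by rw [map_mul]; rfl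

/-- The restriction `V × W → V × (G → W)`. -/
def freeRes : V × W →ₗ[F] V × (Fin (Fintype.card G) → W) :=
  -- At `G/G`, `w` stands for the transfer of the generator `w` at `G/e`, so it restricts to a norm,
  -- a constant function.
  LinearMap.prodMap LinearMap.id (LinearMap.pi fun _ => LinearMap.id)

/-- The transfer `V × (G → W) → V × W`. -/
def freeTr : V × (Fin (Fintype.card G) → W) →ₗ[F] V × W :=
  -- Elements of `V` are restrictions at `G/e`, and the transfer of a restriction is a multiple of
  -- `|G| = 0`.
  LinearMap.prodMap 0 (∑ i, LinearMap.proj i)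

omit [Group G] in
theorem freeTr_apply (v : V) (φ : Fin (Fintype.card G) → W) :
    freeTr (F := F) G V W (v, φ) = (0, ∑ i, φ i) := by
  simp [freeTr]

variable {G}

omit [Group G] in
theorem card_nsmul_eq_zero {V : Type u} [AddCommGroup V] [Module F V]
    (hG : (Fintype.card G : F) = 0) (v : V) : Fintype.card G • v = 0 := by
  rw [← Nat.cast_smul_eq_nsmul F, hG, zero_smul]

/-- The module that is free on the vector space `V` at `G/G` and on the vector space `W` at
`G/e`. -/
noncomputable def freeOn : GreenModule (GreenFunctor.const G F) :=
  ofLinear (freeRho G V W) (freeRes G V W) (freeTr G V W)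
    (fun _ _ => rfl)
    (fun g x => by
      obtain ⟨v, φ⟩ := x
      change freeTr (F := F) G V W (v, translation (F := F) G W g φ) = _
      rw [freeTr_apply, freeTr_apply, sum_translation])
    (fun x => by
      obtain ⟨v, φ⟩ := x
      rw [freeTr_apply]
      refine Prod.ext ?_ (funext fun i => ?_)
      · rw [Prod.fst_sum]
        change (0 : V) = ∑ _g : G, v
        rw [Finset.sum_const, Finset.card_univ, card_nsmul_eq_zero hG]
      · rw [Prod.snd_sum, Finset.sum_apply]
        exact (sum_translation_apply (F := F) φ i).symm)
    (fun m => by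
      obtain ⟨v, w⟩ := m
      change freeTr (F := F) G V W (v, fun _ => w) = _
      rw [freeTr_apply, hG, zero_smul, Finset.sum_const, Finset.card_univ, Fintype.card_fin,
        card_nsmul_eq_zero hG]
      rfl)

end FreeOn

/-! ### The universal property of free modules -/

section Basis

variable {V W : Type u} [AddCommGroup V] [Module F V] [AddCommGroup W] [Module F W]
variable {N : GreenModule (GreenFunctor.const G F)} (a : V →ₗ[F] N.top) (b : W →ₗ[F] N.bot)

/-- The map at `G/G` out of the free module on `V` and `W`, given by its values on `V` and `W`. -/
def freeTop : V × W →ₗ[F] N.top := a.coprod (N.trL ∘ₗ b)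

/-- The map at `G/e` out of the free module on `V` and `W`, given by its values on `V` and `W`. -/
noncomputable def freeBot : V × (Fin (Fintype.card G) → W) →ₗ[F] N.bot :=
  (N.resL ∘ₗ a).coprod
    -- The inverse turns right translation of functions into the left action: with `k = h g` one has
    -- `h⁻¹ = g k⁻¹`.
    (∑ i, N.rho ((Fintype.equivFin G).symm i)⁻¹ ∘ₗ b ∘ₗ LinearMap.proj i)

theorem freeTop_apply (v : V) (w : W) : freeTop a b (v, w) = a v + N.trL (b w) := rfl

theorem freeBot_apply (v : V) (φ : Fin (Fintype.card G) → W) :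
    freeBot a b (v, φ) = N.resL (a v) + ∑ g : G, N.rho g⁻¹ (b (φ (Fintype.equivFin G g))) := by
  rw [freeBot, LinearMap.coprod_apply, LinearMap.sum_apply, sum_fin_card]
  simp

/-- Functions supported at the identity are the copy of `W` that generates at `G/e`. -/
theorem freeBot_single (w : W) :
    freeBot a b (0, Pi.single (Fintype.equivFin G 1) w) = b w := by
  rw [freeBot_apply, map_zero, map_zero, zero_add, Finset.sum_eq_single 1]
  · simp
  · intro g _ hg
    rw [Pi.single_eq_of_ne (by simpa using hg), map_zero, map_zero]
  · simp

theorem freeBot_rho (g : G) (z) : freeBot a b (freeRho (F := F) G V W g z) = N.rho g (freeBot a b z) := by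
  obtain ⟨v, φ⟩ := z
  change freeBot a b (v, translation (F := F) G W g φ) = _
  simp only [freeBot_apply, map_add, rho_resL, map_sum, translation_apply, Equiv.symm_apply_apply]
  congr 1
  refine Fintype.sum_equiv (Equiv.mulRight g) _ _ fun h => ?_
  rw [← Module.End.mul_apply, ← map_mul]
  simp

theorem freeBot_res (z) : freeBot a b (freeRes (F := F) G V W z) = N.resL (freeTop a b z) := by
  obtain ⟨v, w⟩ := z
  change freeBot a b (v, fun _ => w) = _
  rw [freeBot_apply, freeTop_apply, map_add, resL_trL]
  congr 1
  exact Fintype.sum_equiv (Equiv.inv G) _ _ fun g => rfl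

theorem freeTop_tr (hG : (Fintype.card G : F) = 0) (z) :
    freeTop a b (freeTr (F := F) G V W z) = N.trL (freeBot a b z) := by
  obtain ⟨v, φ⟩ := z
  rw [freeTr_apply, freeTop_apply, freeBot_apply, map_add, trL_resL, hG, zero_smul, map_zero,
    zero_add, zero_add, sum_fin_card, map_sum, map_sum, map_sum]
  exact Finset.sum_congr rfl fun g _ => (trL_rho _ _ _).symm

/-- The morphism out of the free module on `V` and `W`, given by its values on `V` and `W`. -/
noncomputable def freeHom (hG : (Fintype.card G : F) = 0) : freeOn hG V W ⟶ N :=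
  homOfLinear (M := freeOn hG V W) (freeTop a b) (freeBot a b) (freeBot_rho a b) (freeBot_res a b)
    (freeTop_tr a b hG)

/-- The module `N` is free on `V` and `W` by means of the maps `a` and `b`. -/
structure IsFreeOn : Prop where
  top : Function.Bijective (freeTop a b)
  bot : Function.Bijective (freeBot a b)

variable {a b}

/-- Both levels are transported along the bijections; compatibility holds because `freeTop` and
`freeBot` commute with the structure maps in `N` and in `K`. -/
theorem IsFreeOn.exists_extension (h : IsFreeOn a b) (hG : (Fintype.card G : F) = 0)
    {K : GreenModule (GreenFunctor.const G F)} (a' : V →ₗ[F] K.top) (b' : W →ₗ[F] K.bot) :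
    ∃ f : N ⟶ K, (∀ z, Hom.topL f (freeTop a b z) = freeTop a' b' z) ∧
      ∀ z, Hom.botL f (freeBot a b z) = freeBot a' b' z := by
  obtain ⟨α, hα⟩ : ∃ α : N.top →ₗ[F] K.top, ∀ z, α (freeTop a b z) = freeTop a' b' z :=
    ⟨freeTop a' b' ∘ₗ (LinearEquiv.ofBijective _ h.top).symm.toLinearMap, fun z =>
      congrArg (freeTop a' b') ((LinearEquiv.ofBijective _ h.top).symm_apply_apply z)⟩
  obtain ⟨β, hβ⟩ : ∃ β : N.bot →ₗ[F] K.bot, ∀ z, β (freeBot a b z) = freeBot a' b' z :=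
    ⟨freeBot a' b' ∘ₗ (LinearEquiv.ofBijective _ h.bot).symm.toLinearMap, fun z =>
      congrArg (freeBot a' b') ((LinearEquiv.ofBijective _ h.bot).symm_apply_apply z)⟩
  refine ⟨homOfLinear α β (fun g x => ?_) (fun m => ?_) (fun x => ?_), hα, hβ⟩
  · obtain ⟨z, rfl⟩ := h.bot.2 x
    rw [← freeBot_rho, hβ, hβ, freeBot_rho]
  · obtain ⟨z, rfl⟩ := h.top.2 m
    rw [← freeBot_res, hβ, hα, freeBot_res]
  · obtain ⟨z, rfl⟩ := h.bot.2 x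
    rw [← freeTop_tr a b hG, hβ, hα, freeTop_tr a' b' hG]

theorem IsFreeOn.hom_ext (h : IsFreeOn a b) {K : GreenModule (GreenFunctor.const G F)}
    {f f' : N ⟶ K} (ha : ∀ v, Hom.topL f (a v) = Hom.topL f' (a v))
    (hb : ∀ w, Hom.botL f (b w) = Hom.botL f' (b w)) : f = f' := by
  refine hom_ext_of_linear (LinearMap.ext fun m => ?_) (LinearMap.ext fun x => ?_)
  · obtain ⟨⟨m, y⟩, rfl⟩ := h.top.2 m
    simp only [freeTop_apply, map_add, Hom.topL_trL, ha, hb]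
  · obtain ⟨⟨m, φ⟩, rfl⟩ := h.bot.2 x
    simp only [freeBot_apply, map_add, Hom.botL_resL, map_sum, Hom.botL_rho, ha, hb]

theorem IsFreeOn.isFree (h : IsFreeOn a b) (hG : (Fintype.card G : F) = 0) : N.IsFree := by
  obtain ⟨I, ⟨v⟩⟩ := Module.Basis.exists_basis F V
  obtain ⟨J, ⟨w⟩⟩ := Module.Basis.exists_basis F W
  refine ⟨I, J, fun i => a (v i), fun j => b (w j), fun K s t => ?_⟩
  obtain ⟨f, hf, hf'⟩ := h.exists_extension hG (v.constr F s) (w.constr F t)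
  have h₁ : ∀ x, Hom.topL f (a x) = v.constr F s x := fun x => by
    simpa [freeTop_apply] using hf (x, 0)
  have h₂ : ∀ y, Hom.botL f (b y) = w.constr F t y := fun y => by
    have e := hf' (0, Pi.single (Fintype.equivFin G 1) y)
    rwa [freeBot_single, freeBot_single] at e
  refine ⟨f, ⟨fun i => (h₁ _).trans (v.constr_basis F s i),
    fun j => (h₂ _).trans (w.constr_basis F t j)⟩, fun f' hf' => h.hom_ext ?_ ?_⟩
  · exact fun x => LinearMap.congr_fun (f := Hom.topL f' ∘ₗ a) (g := Hom.topL f ∘ₗ a)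
      (v.ext fun i => (hf'.1 i).trans ((h₁ _).trans (v.constr_basis F s i)).symm) x
  · exact fun y => LinearMap.congr_fun (f := Hom.botL f' ∘ₗ b) (g := Hom.botL f ∘ₗ b)
      (w.ext fun j => (hf'.2 j).trans ((h₂ _).trans (w.constr_basis F t j)).symm) y

end Basis

/-! ### Free modules are flat -/

section Flat

variable {V W : Type u} [AddCommGroup V] [Module F V] [AddCommGroup W] [Module F W]
variable {M : GreenModule (GreenFunctor.const G F)} (a : V →ₗ[F] M.top) (b : W →ₗ[F] M.bot)
variable (N : GreenModule (GreenFunctor.const G F))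

/-- The product `M(G/G) ⊗ N(G/G) → (M ⊠ N)(G/G)`, as an `F`-linear map. -/
def boxInl : M.top ⊗[F] N.top →ₗ[F] (M.box N).top := Box.inl M N

/-- The transfer of the box product, as an `F`-linear map. -/
def boxTr : M.bot ⊗[F] N.bot →ₗ[F] (M.box N).top := (M.box N).trL

theorem boxInl_tr_left (x : M.bot) (n : N.top) :
    boxInl N (M.trL x ⊗ₜ n) = boxTr N (x ⊗ₜ[F] N.resL n) := Box.inl_tr_left M N x n

theorem boxInl_tr_right (m : M.top) (y : N.bot) :
    boxInl N (m ⊗ₜ N.trL y) = boxTr N (M.resL m ⊗ₜ[F] y) := Box.inl_tr_right M N m y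

theorem boxTr_rho (g : G) (x : M.bot) (y : N.bot) :
    boxTr N (M.rho g x ⊗ₜ[F] N.rho g y) = boxTr N (x ⊗ₜ[F] y) := Box.tr_act M N g (x ⊗ₜ y)

/-- Linear maps out of the value of a box product at `G/G`. -/
def boxLift {P : Type*} [AddCommGroup P] [Module F P] {N : GreenModule (GreenFunctor.const G F)}
    (α : M.top ⊗[F] N.top →ₗ[F] P) (β : M.bot ⊗[F] N.bot →ₗ[F] P)
    (h₁ : ∀ x n, α (M.trL x ⊗ₜ n) = β (x ⊗ₜ N.resL n))
    (h₂ : ∀ m y, α (m ⊗ₜ N.trL y) = β (M.resL m ⊗ₜ y))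
    (h₃ : ∀ g x y, β (M.rho g x ⊗ₜ N.rho g y) = β (x ⊗ₜ y)) : (M.box N).top →ₗ[F] P :=
  letI : Module (GreenFunctor.const G F).top P := inferInstanceAs (Module F P)
  Box.lift (M := M) (N := N) α
    { toFun := β
      map_add' := map_add β
      map_smul' := fun c w => by
        rw [Box.top_smul]
        exact β.map_smul c w } h₁ h₂ (fun g w => by
      change β (Box.act M N g w) = β w
      induction w using TensorProduct.induction_on with
      | zero => rw [map_zero]
      | tmul x y => exact h₃ g x y
      | add v w hv hw => rw [map_add]; erw [map_add, map_add, hv, hw])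

theorem boxLift_inl {P : Type*} [AddCommGroup P] [Module F P]
    {N : GreenModule (GreenFunctor.const G F)}
    (α : M.top ⊗[F] N.top →ₗ[F] P) (β : M.bot ⊗[F] N.bot →ₗ[F] P) (h₁ h₂ h₃) (z) :
    boxLift α β h₁ h₂ h₃ (boxInl N z) = α z :=
  letI : Module (GreenFunctor.const G F).top P := inferInstanceAs (Module F P)
  Box.lift_inl (M := M) (N := N) (P := P) _ _ _ _ _ _

theorem boxLift_tr {P : Type*} [AddCommGroup P] [Module F P]
    {N : GreenModule (GreenFunctor.const G F)}
    (α : M.top ⊗[F] N.top →ₗ[F] P) (β : M.bot ⊗[F] N.bot →ₗ[F] P) (h₁ h₂ h₃) (z) :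
    boxLift α β h₁ h₂ h₃ (boxTr N z) = β z :=
  letI : Module (GreenFunctor.const G F).top P := inferInstanceAs (Module F P)
  Box.lift_tr (M := M) (N := N) (P := P) _ _ _ _ _ _

theorem boxMap_inl {N N' : GreenModule (GreenFunctor.const G F)} (f : N ⟶ N') (m : M.top)
    (n : N.top) :
    Hom.topL (M.boxMap f) (boxInl N (m ⊗ₜ n)) = boxInl N' (m ⊗ₜ Hom.topL f n) :=
  Box.mapTop_inl M f m n

theorem boxMap_tr {N N' : GreenModule (GreenFunctor.const G F)} (f : N ⟶ N') (x : M.bot)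
    (y : N.bot) :
    Hom.topL (M.boxMap f) (boxTr N (x ⊗ₜ y)) = boxTr N' (x ⊗ₜ Hom.botL f y) :=
  Box.mapTop_tr M f (x ⊗ₜ y)

/-- The map `V ⊗ N(G/G) ⊕ W ⊗ N(G/e) → (M ⊠ N)(G/G)`. -/
def freeBoxTop : (V ⊗[F] N.top) × (W ⊗[F] N.bot) →ₗ[F] (M.box N).top :=
  (boxInl N ∘ₗ a.rTensor N.top).coprod (boxTr N ∘ₗ b.rTensor N.bot)

theorem freeBoxTop_apply (s t) :
    freeBoxTop a b N (s, t) = boxInl N (a.rTensor N.top s) + boxTr N (b.rTensor N.bot t) := rfl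

variable {a b}

/-- The relations move every class into the two summands: `tr (res (a v) ⊗ y) = a v ⊗ tr y`, `tr
(g⁻¹ b w ⊗ y) = tr (b w ⊗ g y)` and `tr x ⊗ n = tr (x ⊗ res n)`. -/
theorem IsFreeOn.surjective_freeBoxTop (h : IsFreeOn a b) :
    Function.Surjective (freeBoxTop a b N) := by
  rw [← LinearMap.range_eq_top]
  have hr : ∀ x y, boxTr N (x ⊗ₜ y) ∈ LinearMap.range (freeBoxTop a b N) := fun x y => by
    obtain ⟨⟨v, φ⟩, rfl⟩ := h.bot.2 x
    rw [freeBot_apply, TensorProduct.add_tmul, TensorProduct.sum_tmul, map_add, map_sum,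
      ← boxInl_tr_right]
    refine add_mem ⟨(v ⊗ₜ N.trL y, 0), by simp [freeBoxTop_apply]⟩ (sum_mem fun g _ => ?_)
    refine ⟨(0, φ (Fintype.equivFin G g) ⊗ₜ N.rho g y), ?_⟩
    rw [← boxTr_rho N g]
    simp [freeBoxTop_apply]
  have hr' : ∀ z, boxTr N z ∈ LinearMap.range (freeBoxTop a b N) := fun z => by
    induction z using TensorProduct.induction_on with
    | zero => rw [map_zero]; exact zero_mem _
    | tmul x y => exact hr x y
    | add s t hs ht => rw [map_add]; exact add_mem hs ht
  refine eq_top_iff.2 fun z _ => ?_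
  induction z using Box.top_induction with
  | hl m n =>
    obtain ⟨⟨v, y⟩, rfl⟩ := h.top.2 m
    change boxInl N (freeTop a b (v, y) ⊗ₜ n) ∈ _
    rw [freeTop_apply, TensorProduct.add_tmul, map_add, boxInl_tr_left]
    exact add_mem ⟨(v ⊗ₜ n, 0), by simp [freeBoxTop_apply]⟩ (hr _ _)
  | hr w => exact hr' w
  | ha z z' hz hz' => exact add_mem (hz trivial) (hz' trivial)

/-- The reductions that prove surjectivity, read as formulas on `M(G/G) ⊗ N(G/G)` and `M(G/e) ⊗
N(G/e)`, respect the relations and so define a left inverse `L`. -/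
theorem IsFreeOn.injective_freeBoxTop (h : IsFreeOn a b) (hG : (Fintype.card G : F) = 0) :
    Function.Injective (freeBoxTop a b N) := by
  let eT := LinearEquiv.ofBijective _ h.top
  let eB := LinearEquiv.ofBijective _ h.bot
  let α : M.top ⊗[F] N.top →ₗ[F] (V ⊗[F] N.top) × (W ⊗[F] N.bot) :=
    (TensorProduct.map (LinearMap.fst F V W ∘ₗ eT.symm.toLinearMap) LinearMap.id).prod
      (TensorProduct.map (LinearMap.snd F V W ∘ₗ eT.symm.toLinearMap) N.resL)
  let β : M.bot ⊗[F] N.bot →ₗ[F] (V ⊗[F] N.top) × (W ⊗[F] N.bot) :=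
    (TensorProduct.map (LinearMap.fst F V _ ∘ₗ eB.symm.toLinearMap) N.trL).prod
      (∑ g : G, TensorProduct.map (LinearMap.proj (Fintype.equivFin G g) ∘ₗ
        LinearMap.snd F V _ ∘ₗ eB.symm.toLinearMap) (N.rho g))
  have hT : ∀ z, eT.symm (freeTop a b z) = z := eT.symm_apply_apply
  have hB : ∀ z, eB.symm (freeBot a b z) = z := eB.symm_apply_apply
  have hα : ∀ v w n, α (freeTop a b (v, w) ⊗ₜ n) = (v ⊗ₜ n, w ⊗ₜ N.resL n) := fun v w n => by
    simp [α, hT]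
  have hβ : ∀ v φ y, β (freeBot a b (v, φ) ⊗ₜ y) =
      (v ⊗ₜ N.trL y, ∑ g : G, φ (Fintype.equivFin G g) ⊗ₜ N.rho g y) := fun v φ y => by
    simp [β, hB]
  let L := boxLift α β
    -- The `V`-components agree because `tr (res n) = 0`, the `W`-components because `res n` is
    -- fixed by `G`.
    (fun x n => by
      obtain ⟨⟨v, φ⟩, rfl⟩ := h.bot.2 x
      rw [← freeTop_tr a b hG, freeTr_apply, hα, hβ, trL_resL, hG, zero_smul,
        TensorProduct.tmul_zero, TensorProduct.zero_tmul, sum_fin_card, TensorProduct.sum_tmul]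
      simp only [rho_resL])
    (fun m y => by
      obtain ⟨⟨v, w⟩, rfl⟩ := h.top.2 m
      rw [← freeBot_res, hα, resL_trL, TensorProduct.tmul_sum]
      exact (hβ v (fun _ => w) y).symm)
    (fun g x y => by
      obtain ⟨⟨v, φ⟩, rfl⟩ := h.bot.2 x
      rw [← freeBot_rho, hβ, hβ]
      refine Prod.ext (by rw [trL_rho]; rfl) ?_
      change ∑ k : G, translation (F := F) G W g φ (Fintype.equivFin G k) ⊗ₜ _ = _
      refine Fintype.sum_equiv (Equiv.mulRight g) _ _ fun k => ?_
      simp [translation_apply])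
  refine Function.LeftInverse.injective (g := L) fun z => ?_
  obtain ⟨s, t⟩ := z
  rw [freeBoxTop_apply, map_add, boxLift_inl, boxLift_tr]
  have hs : α (a.rTensor N.top s) = (s, 0) := by
    induction s using TensorProduct.induction_on with
    | zero => rw [map_zero, map_zero]; rfl
    | tmul v n =>
      have e : a v = freeTop a b (v, 0) := by simp [freeTop_apply]
      rw [LinearMap.rTensor_tmul, e, hα, TensorProduct.zero_tmul]
    | add s s' hs hs' => rw [map_add, map_add, hs, hs']; simp
  have ht : β (b.rTensor N.bot t) = (0, t) := by
    induction t using TensorProduct.induction_on with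
    | zero => rw [map_zero, map_zero]; rfl
    | tmul w y =>
      rw [LinearMap.rTensor_tmul, ← freeBot_single a b w, hβ, TensorProduct.zero_tmul,
        Finset.sum_eq_single 1]
      · simp
      · intro g _ hg
        rw [Pi.single_eq_of_ne (by simpa using hg), TensorProduct.zero_tmul]
      · simp
    | add s s' hs hs' => rw [map_add, map_add, hs, hs']; simp
  rw [hs, ht]
  simp

/-- Naturality in `N`: at `G/G` the functor `M ⊠ -` becomes a sum of two ordinary tensor functors.
-/
theorem boxMap_freeBoxTop {N N' : GreenModule (GreenFunctor.const G F)} (f : N ⟶ N') (s t) :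
    Hom.topL (M.boxMap f) (freeBoxTop a b N (s, t)) =
      freeBoxTop a b N' ((Hom.topL f).lTensor V s, (Hom.botL f).lTensor W t) := by
  rw [freeBoxTop_apply, freeBoxTop_apply, map_add]
  congr 1
  · induction s using TensorProduct.induction_on with
    | zero => simp
    | tmul v n => exact boxMap_inl f _ _
    | add s s' hs hs' => simp only [map_add, hs, hs']
  · induction t using TensorProduct.induction_on with
    | zero => simp
    | tmul v n => exact boxMap_tr f _ _
    | add s s' hs hs' => simp only [map_add, hs, hs']

theorem IsFreeOn.isFlat (h : IsFreeOn a b) (hG : (Fintype.card G : F) = 0) : M.IsFlat := by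
  intro N₁ N₂ N₃ f g hfg
  have ft : Function.Injective (Hom.topL f) := hfg.injective_top
  have fb : Function.Injective (Hom.botL f) := hfg.injective_bot
  have et : Function.Exact (Hom.topL f) (Hom.topL g) := hfg.exact_top
  have eb : Function.Exact (Hom.botL f) (Hom.botL g) := hfg.exact_bot
  have gt : Function.Surjective (Hom.topL g) := hfg.surjective_top
  have gb : Function.Surjective (Hom.botL g) := hfg.surjective_bot
  have et' := fun V : Type u => fun [AddCommGroup V] [Module F V] => Module.Flat.lTensor_exact V et
  have eb' := fun V : Type u => fun [AddCommGroup V] [Module F V] => Module.Flat.lTensor_exact V eb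
  have i := fun N => h.injective_freeBoxTop N hG
  have s := fun N => h.surjective_freeBoxTop N
  have key : Function.Injective (Hom.topL (M.boxMap f)) ∧
      Function.Exact (Hom.topL (M.boxMap f)) (Hom.topL (M.boxMap g)) ∧
      Function.Surjective (Hom.topL (M.boxMap g)) := by
    refine ⟨?_, ?_, ?_⟩
    · refine (injective_iff_map_eq_zero _).2 fun z hz => ?_
      obtain ⟨⟨x, y⟩, rfl⟩ := s _ z
      rw [boxMap_freeBoxTop, ← map_zero (freeBoxTop a b N₂)] at hz
      have hz' := i _ hz
      rw [Prod.mk_eq_zero] at hz'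
      rw [(injective_iff_map_eq_zero _).1
          (Module.Flat.lTensor_preserves_injective_linearMap (M := V) _ ft) _ hz'.1,
        (injective_iff_map_eq_zero _).1
          (Module.Flat.lTensor_preserves_injective_linearMap (M := W) _ fb) _ hz'.2]
      exact map_zero _
    · intro z
      obtain ⟨⟨x, y⟩, rfl⟩ := s _ z
      rw [boxMap_freeBoxTop]
      constructor
      · intro hz
        rw [← map_zero (freeBoxTop a b N₃)] at hz
        have hz' := i _ hz
        rw [Prod.mk_eq_zero] at hz'
        obtain ⟨x, rfl⟩ := (et' V _).1 hz'.1
        obtain ⟨y, rfl⟩ := (eb' W _).1 hz'.2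
        exact ⟨_, boxMap_freeBoxTop f x y⟩
      · rintro ⟨z, hz⟩
        obtain ⟨⟨x', y'⟩, rfl⟩ := s _ z
        rw [boxMap_freeBoxTop] at hz
        obtain ⟨rfl, rfl⟩ := Prod.ext_iff.1 (i _ hz)
        rw [(et' V _).2 ⟨x', rfl⟩, (eb' W _).2 ⟨y', rfl⟩]
        exact map_zero _
    · intro z
      obtain ⟨⟨x, y⟩, rfl⟩ := s _ z
      obtain ⟨x, rfl⟩ := LinearMap.lTensor_surjective V gt x
      obtain ⟨y, rfl⟩ := LinearMap.lTensor_surjective W gb y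
      exact ⟨_, boxMap_freeBoxTop g x y⟩
  have inj : Function.Injective ((Hom.botL f).lTensor M.bot) :=
    Module.Flat.lTensor_preserves_injective_linearMap _ fb
  exact
    { injective_top := key.1
      exact_top := key.2.1
      surjective_top := key.2.2
      injective_bot := inj
      exact_bot := eb' M.bot
      surjective_bot := LinearMap.lTensor_surjective M.bot gb }

end Flat

/-! ### A criterion for freeness -/

/-- The criterion for freeness: the restriction is injective, and the kernel of the transfer is
generated by restrictions and by differences `g x - x`. -/
structure IsTame (M : GreenModule (GreenFunctor.const G F)) : Prop where
  injective_resL : Function.Injective M.resL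
  ker_trL : LinearMap.ker M.trL ≤
    Representation.Coinvariants.ker M.rho ⊔ LinearMap.range M.resL

/-- Morphisms commute with restriction and transfer and preserve differences `g x - x`, so both
conditions go up along `i` and come back along `r`. -/
theorem IsTame.of_retract {M P : GreenModule (GreenFunctor.const G F)} (i : M ⟶ P) (r : P ⟶ M)
    (h : i ≫ r = 𝟙 M) (hP : P.IsTame) : M.IsTame where
  injective_resL m m' hm := by
    have ht : ∀ m, Hom.topL r (Hom.topL i m) = m :=
      LinearMap.congr_fun (congrArg Hom.topL h)
    rw [← ht m, ← ht m']
    refine congrArg _ (hP.injective_resL ?_)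
    rw [← Hom.botL_resL, ← Hom.botL_resL, hm]
  ker_trL x hx := by
    have hb : Hom.botL r (Hom.botL i x) = x := LinearMap.congr_fun (congrArg Hom.botL h) x
    rw [LinearMap.mem_ker] at hx
    have hle : Representation.Coinvariants.ker P.rho ⊔ LinearMap.range P.resL ≤
        (Representation.Coinvariants.ker M.rho ⊔ LinearMap.range M.resL).comap (Hom.botL r) := by
      refine sup_le (Submodule.span_le.2 ?_) ?_
      · rintro _ ⟨⟨g, y⟩, rfl⟩
        refine Submodule.mem_sup_left ?_
        rw [map_sub, Hom.botL_rho]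
        exact Representation.Coinvariants.sub_mem_ker g _
      · rintro _ ⟨y, rfl⟩
        exact Submodule.mem_sup_right ⟨Hom.topL r y, (Hom.botL_resL r y).symm⟩
    rw [← hb]
    refine hle (hP.ker_trL ?_)
    rw [LinearMap.mem_ker, ← Hom.topL_trL, hx, map_zero]

/-! ### Free and projective modules satisfy the criterion -/

section Free

variable (V W : Type u) [AddCommGroup V] [Module F V] [AddCommGroup W] [Module F W]

/-- A function supported at `g` is a translate of one supported at `1`, so modulo differences all
the mass of `φ` can be moved to `1`. -/
theorem sub_single_sum_mem_coinvariantsKer (φ : Fin (Fintype.card G) → W) :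
    ((0, φ) - (0, Pi.single (Fintype.equivFin G 1) (∑ i, φ i)) :
      V × (Fin (Fintype.card G) → W)) ∈
        Representation.Coinvariants.ker (freeRho (F := F) G V W) := by
  have h : ∀ g w, (0, Pi.single (Fintype.equivFin G g) w) =
      freeRho (F := F) G V W g⁻¹ (0, Pi.single (Fintype.equivFin G 1) w) := fun g w => by
    refine Prod.ext rfl (funext fun i => ?_)
    change _ = translation (F := F) G W g⁻¹ (Pi.single (Fintype.equivFin G 1) w) i
    rw [translation_apply]
    simp [Pi.single_apply, Equiv.symm_apply_eq, mul_inv_eq_one]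
  have e : ((0, φ) - (0, Pi.single (Fintype.equivFin G 1) (∑ i, φ i)) :
      V × (Fin (Fintype.card G) → W)) =
      ∑ i, ((0, Pi.single i (φ i)) - (0, Pi.single (Fintype.equivFin G 1) (φ i))) := by
    refine Prod.ext (by simp [Prod.fst_sum]) ?_
    rw [Prod.snd_sum]
    simp only [Prod.snd_sub, Finset.sum_sub_distrib, Finset.univ_sum_single]
    exact congrArg (φ - ·)
      (map_sum (AddMonoidHom.single (fun _ => W) (Fintype.equivFin G 1)) φ Finset.univ)
  rw [e]
  refine sum_mem fun i _ => ?_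
  have := h ((Fintype.equivFin G).symm i) (φ i)
  rw [Equiv.apply_symm_apply] at this
  rw [this]
  exact Representation.Coinvariants.sub_mem_ker _ _

theorem isTame_freeOn (hG : (Fintype.card G : F) = 0) : (freeOn hG V W).IsTame where
  injective_resL := by
    rintro ⟨v, w⟩ ⟨v', w'⟩ h
    obtain ⟨h₁, h₂⟩ := Prod.ext_iff.1 h
    exact Prod.ext h₁ (congrFun h₂ (Fintype.equivFin G 1))
  ker_trL := by
    rintro ⟨v, φ⟩ h
    have h' : freeTr (F := F) G V W (v, φ) = 0 := h
    rw [freeTr_apply] at h'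
    have hs : ∑ i, φ i = 0 := (Prod.ext_iff.1 h').2
    have hφ := sub_single_sum_mem_coinvariantsKer (F := F) V W φ
    rw [hs, Pi.single_zero] at hφ
    have e : ((v, φ) : V × (Fin (Fintype.card G) → W)) =
        ((0, φ) - (0, 0)) + freeRes (F := F) G V W (v, 0) :=
      Prod.ext (by simp [freeRes]) (by simp [freeRes])
    rw [e]
    exact Submodule.add_mem_sup hφ ⟨_, rfl⟩

end Free

/-- The free module on the two values of `M` maps onto `M`, and projectivity splits this
epimorphism. -/
theorem isTame_of_projective (hG : (Fintype.card G : F) = 0)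
    (M : GreenModule (GreenFunctor.const G F)) [Projective M] : M.IsTame := by
  let e : freeOn hG M.top M.bot ⟶ M := freeHom LinearMap.id LinearMap.id hG
  have he : Epi e := epi_of_surjective e
    (fun m => ⟨(m, 0), (by simp [freeTop_apply] : freeTop LinearMap.id LinearMap.id (m, 0) = m)⟩)
    (fun x => ⟨(0, Pi.single (Fintype.equivFin G 1) x), freeBot_single LinearMap.id LinearMap.id x⟩)
  exact (isTame_freeOn M.top M.bot hG).of_retract (Projective.factorThru (𝟙 M) e) e
    (Projective.factorThru_comp _ _)

/-! ### Flat modules satisfy the criterion -/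

section Flat

theorem trL_resL_eq_zero (hG : (Fintype.card G : F) = 0)
    (M : GreenModule (GreenFunctor.const G F)) (m : M.top) : M.trL (M.resL m) = 0 := by
  rw [trL_resL, hG, zero_smul]

/-- The constant module `F`. -/
def unit (hG : (Fintype.card G : F) = 0) : GreenModule (GreenFunctor.const G F) :=
  ofLinear (T := F) (B := F) 1 LinearMap.id 0 (fun _ _ => rfl) (fun _ _ => rfl)
    (fun x => by simp [hG]) (fun m => by simp [hG])

/-- The simple module that vanishes at `G/G`. -/
def simpleBot (hG : (Fintype.card G : F) = 0) : GreenModule (GreenFunctor.const G F) :=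
  ofLinear (T := PUnit.{u + 1}) (B := F) 1 0 0 (fun _ _ => rfl) (fun _ _ => rfl)
    (fun x => by simp [hG]) (fun m => rfl)

/-- The inclusion of the simple module that vanishes at `G/G` into the constant module. -/
def simpleBotHom (hG : (Fintype.card G : F) = 0) : simpleBot (G := G) hG ⟶ unit hG :=
  homOfLinear (M := simpleBot hG) (N := unit hG) (0 : PUnit.{u + 1} →ₗ[F] F) (LinearMap.id : F →ₗ[F] F)
    (fun _ _ => rfl) (fun _ => rfl) (fun _ => rfl)

/-- The inclusion of the constant module into the free module on one generator at `G/e`. -/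
noncomputable def unitHom (hG : (Fintype.card G : F) = 0) :
    unit (G := G) hG ⟶ freeOn hG PUnit.{u + 1} F :=
  homOfLinear (M := unit hG) (N := freeOn hG PUnit.{u + 1} F) (LinearMap.inr F PUnit.{u + 1} F)
    (freeRes G PUnit.{u + 1} F ∘ₗ LinearMap.inr F PUnit.{u + 1} F)
    (fun _ _ => rfl) (fun _ => rfl) (fun x => by
      refine Eq.trans (map_zero (LinearMap.inr F PUnit.{u + 1} F)) ?_
      exact (trL_resL_eq_zero hG (freeOn hG PUnit.{u + 1} F) (0, x)).symm)

variable {M : GreenModule (GreenFunctor.const G F)}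

/-- A levelwise injective map and its cokernel form a short exact sequence. -/
theorem IsFlat.injective_boxMap (hM : M.IsFlat) {N N' : GreenModule (GreenFunctor.const G F)}
    (f : N ⟶ N') (ht : Function.Injective (Hom.topL f)) (hb : Function.Injective (Hom.botL f)) :
    Function.Injective (Hom.topL (M.boxMap f)) :=
  (hM f (cokerMk f) (isShortExact_cokerMk f ht hb)).injective_top

theorem IsFlat.isTame (hM : M.IsFlat) (hG : (Fintype.card G : F) = 0) : M.IsTame where
  injective_resL := by
    refine (injective_iff_map_eq_zero _).2 fun m hm => ?_
    -- `unitHom` sends `1` to a transfer `tr y`, hence `m ⊗ 1` to `m ⊗ tr y = tr (res m ⊗ y) = 0`;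
    -- so `m ⊗ 1 = 0` already in `M ⊠ unit`.
    have hf : Function.Injective (Hom.topL (M.boxMap (unitHom hG))) := by
      refine hM.injective_boxMap _ (fun x y h => (Prod.ext_iff.1 h).2) (fun x y h => ?_)
      exact congrFun (Prod.ext_iff.1 h).2 (Fintype.equivFin G 1)
    let y : (freeOn (G := G) hG PUnit.{u + 1} F).bot := (0, Pi.single (Fintype.equivFin G 1) (1 : F))
    let one : (unit (G := G) hG).top := (1 : F)
    have hy : Hom.topL (unitHom hG) one = (freeOn hG PUnit.{u + 1} F).trL y := by
      refine Eq.trans ?_ (freeTr_apply (F := F) G PUnit.{u + 1} F _ _).symm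
      exact Prod.ext rfl (by simp; rfl)
    have h0 : boxInl (unit hG) (m ⊗ₜ[F] one) = 0 := by
      refine hf ?_
      rw [boxMap_inl, hy, boxInl_tr_right, hm, TensorProduct.zero_tmul, map_zero, map_zero]
    -- These maps induce `(M ⊠ unit)(G/G) → M(G/G)` sending `m ⊗ 1` to `m`.
    let α : M.top ⊗[F] (unit (G := G) hG).top →ₗ[F] M.top := (TensorProduct.rid F M.top).toLinearMap
    let β : M.bot ⊗[F] (unit (G := G) hG).bot →ₗ[F] M.top :=
      M.trL ∘ₗ (TensorProduct.rid F M.bot).toLinearMap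
    have hα : ∀ m (c : F), α (m ⊗ₜ[F] (show (unit (G := G) hG).top from c)) = c • m :=
      fun m c => TensorProduct.rid_tmul m c
    have hβ : ∀ x (c : F), β (x ⊗ₜ[F] (show (unit (G := G) hG).bot from c)) = c • M.trL x :=
      fun x c => (congrArg M.trL (TensorProduct.rid_tmul x c)).trans (map_smul _ _ _)
    have hL := boxLift_inl α β (fun x c => (hα _ c).trans (hβ _ c).symm)
      (fun m c => ((hα m 0).trans (zero_smul F m)).trans
        ((hβ _ c).trans ((congrArg (fun z => (show F from c) • z)
          (trL_resL_eq_zero hG M m)).trans (smul_zero _))).symm)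
      (fun g x c => (hβ _ c).trans ((congrArg _ (M.trL_rho g x)).trans (hβ _ c).symm))
      (m ⊗ₜ[F] one)
    rw [h0, map_zero] at hL
    exact ((hα m 1).symm.trans hL.symm).symm.trans (one_smul F m) |>.symm
  ker_trL x hx := by
    -- In `M ⊠ unit`, `1` is a restriction, so `tr (x ⊗ 1) = tr x ⊗ 1 = 0`; injectivity carries this
    -- vanishing back to `M ⊠ simpleBot`.
    have hf : Function.Injective (Hom.topL (M.boxMap (simpleBotHom hG))) :=
      hM.injective_boxMap _ (fun x y _ => Subsingleton.elim (α := PUnit.{u + 1}) x y) (fun x y h => h)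
    let one : (simpleBot (G := G) hG).bot := (1 : F)
    let one' : (unit (G := G) hG).top := (1 : F)
    have h0 : boxTr (simpleBot hG) (x ⊗ₜ[F] one) = 0 := by
      refine hf ?_
      rw [boxMap_tr, map_zero]
      refine (boxInl_tr_left (unit hG) x one').symm.trans ?_
      rw [LinearMap.mem_ker.1 hx, TensorProduct.zero_tmul, map_zero]
    -- Since `simpleBot` vanishes at `G/G`, the only constraints on formal transfers are invariance
    -- and the vanishing of `res m ⊗ c`; hence `x ⊗ c ↦ c x` is well defined modulo `S`.
    let S := Representation.Coinvariants.ker M.rho ⊔ LinearMap.range M.resL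
    let β : M.bot ⊗[F] (simpleBot (G := G) hG).bot →ₗ[F] M.bot ⧸ S :=
      S.mkQ ∘ₗ (TensorProduct.rid F M.bot).toLinearMap
    have hβ : ∀ x (c : F), β (x ⊗ₜ[F] (show (simpleBot (G := G) hG).bot from c)) = c • S.mkQ x :=
      fun x c => (congrArg S.mkQ (TensorProduct.rid_tmul x c)).trans (map_smul _ _ _)
    have hL := boxLift_tr (0 : M.top ⊗[F] (simpleBot (G := G) hG).top →ₗ[F] M.bot ⧸ S) β
      (fun x n => ((hβ x 0).trans (zero_smul F _)).symm)
      (fun m c => ((hβ _ c).trans ((congrArg (fun z => (show F from c) • z)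
        ((Submodule.Quotient.mk_eq_zero S).2
          (Submodule.mem_sup_right ⟨m, rfl⟩ : M.resL m ∈ S))).trans (smul_zero _))).symm)
      (fun g x c => by
        refine (hβ _ c).trans (Eq.trans ?_ (hβ _ c).symm)
        refine congrArg _ ((Submodule.Quotient.eq S).2 (Submodule.mem_sup_left ?_))
        exact Representation.Coinvariants.sub_mem_ker g x)
      (x ⊗ₜ[F] one)
    rw [h0, map_zero] at hL
    exact (Submodule.Quotient.mk_eq_zero S).1
      ((one_smul F _).symm.trans ((hβ x 1).symm.trans hL.symm))

end Flat

/-! ### The criterion implies freeness -/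

section Criterion

/-- Evaluate `(X - 1) ^ p = X ^ p - 1`, valid in the commutative ring `F[X]`, at `s`. -/
theorem sub_one_pow_eq_zero_of_pow_eq_one (p : ℕ) [Fact p.Prime] [CharP F p] {B : Type*}
    [AddCommGroup B] [Module F B] {s : Module.End F B} (hs : s ^ p = 1) : (s - 1) ^ p = 0 := by
  have h := congrArg (Polynomial.aeval s) (sub_pow_char (p := p) (Polynomial.X : Polynomial F) 1)
  simpa [hs] using h

/-- Nakayama for a nilpotent operator: iterating `x = w + d y` gives `x ∈ W + range (d ^ i)` for all
`i`. -/
theorem eq_top_of_sup_range_eq_top {B : Type*} [AddCommGroup B] [Module F B] {d : Module.End F B}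
    {n : ℕ} (hd : d ^ n = 0) {W : Submodule F B} (hW : ∀ x ∈ W, d x ∈ W)
    (h : W ⊔ LinearMap.range d = ⊤) : W = ⊤ := by
  have key : ∀ i : ℕ, ∀ x, ∃ w ∈ W, ∃ y, w + (d ^ i) y = x := by
    intro i
    induction i with
    | zero => exact fun x => ⟨0, zero_mem _, x, by simp⟩
    | succ i ih =>
      intro x
      obtain ⟨w, hw, _, ⟨y, rfl⟩, rfl⟩ := Submodule.mem_sup.1 (h ▸ Submodule.mem_top : x ∈ _)
      obtain ⟨w', hw', y', rfl⟩ := ih y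
      exact ⟨w + d w', add_mem hw (hW _ hw'), y', by rw [pow_succ', map_add, add_assoc]; rfl⟩
  refine eq_top_iff.2 fun x _ => ?_
  obtain ⟨w, hw, y, rfl⟩ := key n x
  simpa [hd] using hw

/-- Dual to Nakayama: a nonzero stable subspace contains a nonzero vector killed by a nilpotent `d`.
-/
theorem eq_zero_of_sub_one_pow_apply {B : Type*} [AddCommGroup B] [Module F B] {d : Module.End F B}
    {n : ℕ} (hd : d ^ n = 0) {K : Submodule F B} (hK : ∀ x ∈ K, d x ∈ K)
    (h : ∀ x ∈ K, d x = 0 → x = 0) : ∀ x ∈ K, x = 0 := by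
  have key : ∀ i : ℕ, ∀ x ∈ K, (d ^ i) x = 0 → x = 0 := by
    intro i
    induction i with
    | zero => exact fun x _ hx => hx
    | succ i ih =>
      intro x hx hdx
      exact h x hx (ih _ (hK x hx) (by rw [pow_succ] at hdx; exact hdx))
  exact fun x hx => key n x hx (by rw [hd]; rfl)

/-- Every `g` is a power of `s`, and `s ^ n - 1` is divisible by `s - 1`. -/
theorem coinvariantsKer_le_range {B : Type*} [AddCommGroup B] [Module F B]
    (ρ : Representation F G B) {s : G} (hs : ∀ g, g ∈ Subgroup.zpowers s) :
    Representation.Coinvariants.ker ρ ≤ LinearMap.range (ρ s - 1) := by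
  refine Submodule.span_le.2 ?_
  rintro _ ⟨⟨g, x⟩, rfl⟩
  obtain ⟨n, rfl⟩ := mem_powers_iff_mem_zpowers.2 (hs g)
  refine ⟨(∑ i ∈ Finset.range n, ρ s ^ i) x, ?_⟩
  rw [← Module.End.mul_apply, mul_geom_sum]
  simp

theorem rho_eq_of_rho_generator_eq {B : Type*} [AddCommGroup B] [Module F B]
    (ρ : Representation F G B) {s : G} (hs : ∀ g, g ∈ Subgroup.zpowers s) {x : B}
    (hx : ρ s x = x) (g : G) : ρ g x = x := by
  obtain ⟨n, rfl⟩ := mem_powers_iff_mem_zpowers.2 (hs g)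
  induction n with
  | zero => simp
  | succ n ih =>
    change ρ (s ^ n) x = x at ih
    change ρ (s ^ (n + 1)) x = x
    rw [pow_succ, map_mul, Module.End.mul_apply, hx, ih]

/-- Translation is transitive on `G`, so a fixed function is constant. -/
theorem mem_range_freeRes_of_fixed (V W : Type u) [AddCommGroup V] [Module F V] [AddCommGroup W]
    [Module F W] {z : V × (Fin (Fintype.card G) → W)}
    (hz : ∀ g, freeRho (F := F) G V W g z = z) : ∃ t, freeRes (F := F) G V W t = z := by
  obtain ⟨v, φ⟩ := z
  refine ⟨(v, φ (Fintype.equivFin G 1)), Prod.ext rfl (funext fun i => ?_)⟩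
  have h := congrFun (Prod.ext_iff.1 (hz ((Fintype.equivFin G).symm i))).2 (Fintype.equivFin G 1)
  refine h.symm.trans ((translation_apply (F := F) _ φ _).trans ?_)
  simp

theorem IsTame.exists_isFreeOn {M : GreenModule (GreenFunctor.const G F)} (hM : M.IsTame) (p : ℕ)
    [hp : Fact p.Prime] [CharP F p] (hG : Fintype.card G = p) :
    ∃ (V : Submodule F M.top) (W : Submodule F M.bot), IsFreeOn V.subtype W.subtype := by
  have hG0 : (Fintype.card G : F) = 0 := by rw [hG, CharP.cast_eq_zero]
  -- The transfer maps `W` isomorphically onto its image, and `V` supplies the rest of `M(G/G)`.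
  obtain ⟨V, hV⟩ := Submodule.exists_isCompl (LinearMap.range M.trL)
  obtain ⟨W, hW⟩ := Submodule.exists_isCompl (LinearMap.ker M.trL)
  have htop : Function.Bijective (freeTop V.subtype W.subtype) := by
    constructor
    · refine (injective_iff_map_eq_zero _).2 ?_
      rintro ⟨v, w⟩ h
      rw [freeTop_apply] at h
      have hv : (v : M.top) ∈ LinearMap.range M.trL := ⟨-w, by
        rw [map_neg]; exact (eq_neg_of_add_eq_zero_left h).symm⟩
      have hv0 : v = 0 := Subtype.ext (Submodule.disjoint_def.1 hV.disjoint _ hv v.2)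
      subst hv0
      rw [map_zero, zero_add] at h
      have hw0 : w = 0 := Subtype.ext (Submodule.disjoint_def.1 hW.disjoint _ h w.2)
      rw [hw0]
      rfl
    · intro m
      obtain ⟨_, ⟨x, rfl⟩, v, hv, rfl⟩ :=
        Submodule.mem_sup.1 (hV.sup_eq_top ▸ Submodule.mem_top : m ∈ _)
      obtain ⟨y, hy, w, hw, rfl⟩ :=
        Submodule.mem_sup.1 (hW.sup_eq_top ▸ Submodule.mem_top : x ∈ _)
      refine ⟨(⟨v, hv⟩, ⟨w, hw⟩), ?_⟩
      rw [freeTop_apply, map_add, LinearMap.mem_ker.1 hy, zero_add, add_comm]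
      rfl
  refine ⟨V, W, htop, ?_⟩
  have hcyc : IsCyclic G := isCyclic_of_prime_card (p := p) (by rw [Nat.card_eq_fintype_card, hG])
  obtain ⟨s, hs⟩ := hcyc.exists_generator
  have hsp : s ^ p = 1 := by rw [← hG, pow_card_eq_one]
  have hnil : ∀ {B : Type u} [AddCommGroup B] [Module F B] (ρ : Representation F G B),
      (ρ s - 1) ^ p = 0 := fun ρ =>
    sub_one_pow_eq_zero_of_pow_eq_one p (by rw [← map_pow, hsp, map_one])
  constructor
  · refine (injective_iff_map_eq_zero _).2 ?_
    refine eq_zero_of_sub_one_pow_apply (hnil (freeRho G V W))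
      (K := LinearMap.ker (freeBot V.subtype W.subtype)) (fun x hx => ?_) (fun x hx hd => ?_)
    · rw [LinearMap.mem_ker] at hx ⊢
      rw [LinearMap.sub_apply, map_sub, freeBot_rho, Module.End.one_apply, hx, map_zero, sub_zero]
    -- A fixed vector is a restriction from `G/G`, where the map is injective; injectivity of
    -- `M.resL` then forces it to vanish.
    · obtain ⟨t, rfl⟩ := mem_range_freeRes_of_fixed _ _
        (rho_eq_of_rho_generator_eq _ hs (sub_eq_zero.1 hd))
      rw [LinearMap.mem_ker, freeBot_res] at hx
      rw [htop.1 ((hM.injective_resL (hx.trans (map_zero _).symm)).trans (map_zero _).symm),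
        map_zero]
  · rw [← LinearMap.range_eq_top]
    refine eq_top_of_sup_range_eq_top (hnil M.rho) ?_ ?_
    · rintro _ ⟨z, rfl⟩
      rw [LinearMap.sub_apply, ← freeBot_rho]
      exact sub_mem ⟨_, rfl⟩ ⟨_, rfl⟩
    · refine eq_top_iff.2 fun x _ => ?_
      obtain ⟨y, hy, w, hw, rfl⟩ :=
        Submodule.mem_sup.1 (hW.sup_eq_top ▸ Submodule.mem_top : x ∈ _)
      refine add_mem ?_ (Submodule.mem_sup_left ⟨_, freeBot_single _ _ (⟨w, hw⟩ : W)⟩)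
      -- Differences lie in the image of `s - 1`; restrictions lie in the range since the map is
      -- onto at `G/G`.
      refine (hM.ker_trL.trans (sup_le ?_ ?_)) hy
      · exact le_sup_of_le_right (coinvariantsKer_le_range M.rho hs)
      · rintro _ ⟨m, rfl⟩
        obtain ⟨z, rfl⟩ := htop.2 m
        rw [← freeBot_res]
        exact Submodule.mem_sup_left ⟨_, rfl⟩

end Criterion

end Constant

end GreenModule

theorem mainTheorem7 (p : ℕ) [Fact p.Prime] {G : Type w} [Group G] [Fintype G]
    (hG : Fintype.card G = p) (F : Type u) [Field F] [CharP F p]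
    (M : GreenModule (GreenFunctor.const G F)) (hM : M.IsFinitelyGenerated) :
    [M.IsFlat, CategoryTheory.Projective M, M.IsFree].TFAE := by
  have hG0 : (Fintype.card G : F) = 0 := by rw [hG, CharP.cast_eq_zero]
  tfae_have 1 → 3 := fun h => by
    obtain ⟨V, W, hVW⟩ := (h.isTame hG0).exists_isFreeOn p hG
    exact hVW.isFree hG0
  tfae_have 3 → 2 := fun h => h.projective
  tfae_have 2 → 1 := fun h => by
    obtain ⟨V, W, hVW⟩ := (GreenModule.isTame_of_projective hG0 M).exists_isFreeOn p hG
    exact hVW.isFlat hG0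
  tfae_finish
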